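/- Let $L=(L_t)_{t\ge 0}$ be a Lévy subordinator (a real-valued Lévy process with $L_0=0$ and nondecreasing paths), with Laplace exponent $\psi(x)=-\log\mathbb{E}\,e^{-xL_1}$, and let $b>0$. For every $n\ge 2$ consider a mixed coherent system with $n$ components, that is, a random structure function $\Phi^{(n)}:\{0,1\}^n\to\{0,1\}$ that is almost surely coherent (nondecreasing in the state of each component, and with no irrelevant component). With $\phi^{(n)}_{j}=\binom{n}{j}^{-1}\sum_{x\in\{0,1\}^n,\,|x|=j}\mathbb{E}\,\Phi^{(n)}(x)$, its signature is $s^{(n)}_k=\phi^{(n)}_{n-k+1}-\phi^{(n)}_{n-k}$, $k=1,\dots,n$. Suppose that $$s^{(n)}_k=C^{(n)}(n-k+1)^{b-1},\qquad k=1,\dots,n,$$ where the constant $C^{(n)}$ is such that $\sum_{k=1}^n s^{(n)}_k=1$. Suppose that the component failure times $T^{(n)}=(T^{(n)}_1,\dots,T^{(n)}_n)$ are independent of $\Phi^{(n)}$ and have the Lévy-frailty Marshall-Olkin distribution with underlying subordinator $L$, i.e. the law of $\big(\inf\{t\ge 0: L_t>\varepsilon_i\}\big)_{i=1}^n$ where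 $\varepsilon_1,\dots,\varepsilon_n$ are iid standard exponential random variables independent of $L$. Let $T^{(n)}_{\rm sys}=\inf\{t\ge 0:\Phi^{(n)}\big((\mathbf 1_{\{T^{(n)}_i>t\}})_{i}\big)=0\}$ be the failure time of the system, and let $D^{(n)}_u=\frac1n\#\{i: T^{(n)}_i\le u\}$ be the proportion of components that have failed by time $u$. 1. For all $t>0$, $\mathbb{P}(T^{(n)}_{\rm sys}>t)\to e^{-\psi(b)t}$ as $n\to\infty$. If $L$ is not almost surely identically zero, then $\psi(b)>0$ and the limit is $\mathbb{P}(e_{\psi(b)}>t)$, where $e_{\psi(b)}$ is an exponential random variable with rate $\psi(b)$. 2. In the limit the system fails when a random proportion $Q$ of the components have failed, where $Q$ has distribution $\mathrm{Beta}(1,b)$ and is independent of $L$. That is: (a) if $Q_n$ satisfies $\mathbb{P}(Q_n=\frac{k}{n+1})=s^{(n)}_k$ for $k=1,\dots,n$, then $Q_n\to Q$ in distribution; (b) jointly with the proportions of failed components at finitely many times, $T^{(n)}_{\rm sys}$ converges in distribution to the first time $\tau=\inf\{t\ge 0: 1-e^{-L_t}>Q\}=\inf\{t\ge 0: L_t>-\log(1-Q)\}$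 at which the limiting proportion $1-e^{-L_t}$ of failed components exceeds $Q$: for all $t>0$, $m\ge 0$, $u_1,\dots,u_m\ge 0$ and every bounded continuous $g:\mathbb{R}^m\to\mathbb{R}$, $$\mathbb{E}\big[g(D^{(n)}_{u_1},\dots,D^{(n)}_{u_m});\,T^{(n)}_{\rm sys}>t\big]\to\mathbb{E}\big[g(1-e^{-L_{u_1}},\dots,1-e^{-L_{u_m}});\,\tau>t\big]\qquad (n\to\infty).$$ -/

import Mathlib

open MeasureTheory ProbabilityTheory Filter Topology
open scoped ENNReal NNReal BoundedContinuousFunction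

namespace Reliability

/-! ### Coherent and mixed coherent systems -/

/-- A structure function on `n` components: it maps a configuration `x`, where `x i = true` means
that component `i` is working, to the state of the system, `true` meaning that it is working. -/
abbrev StructureFunction (n : ℕ) : Type := (Fin n → Bool) → Bool

/-- Component `i` is irrelevant: its state never changes the state of the system. -/
def IsIrrelevant {n : ℕ} (Φ : StructureFunction n) (i : Fin n) : Prop :=
  ∀ x : Fin n → Bool, Φ (Function.update x i false) = Φ (Function.update x i true)

/-- Repairing a component never makes the system fail. -/
def IsMonotoneSystem {n : ℕ} (Φ : StructureFunction n) : Prop :=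
  ∀ (i : Fin n) (x : Fin n → Bool), Φ (Function.update x i false) ≤ Φ (Function.update x i true)

/-- A system is coherent if it is monotone and has no irrelevant components. -/
def IsCoherent {n : ℕ} (Φ : StructureFunction n) : Prop :=
  IsMonotoneSystem Φ ∧ ∀ i : Fin n, ¬ IsIrrelevant Φ i

/-- A mixed coherent system: a random structure function (it takes finitely many values) that is
almost surely coherent. -/
structure IsMixedCoherent {Ω : Type*} [MeasurableSpace Ω] {n : ℕ}
    (Φ : Ω → StructureFunction n) (P : Measure Ω) : Prop where
  measurable : Measurable Φ
  coherent : ∀ᵐ ω ∂P, IsCoherent (Φ ω)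

/-- The number `|x|` of working components in the configuration `x`. -/
def numWorking {n : ℕ} (x : Fin n → Bool) : ℕ :=
  (Finset.univ.filter fun i => x i = true).card

/-- The expected proportion `φ_j`, among the configurations with exactly `j` working components,
of those in which the system works: `(∑_{|x| = j} 𝔼 Φ(x)) / (n choose j)`. -/
noncomputable def workingProportion {Ω : Type*} [MeasurableSpace Ω] {n : ℕ}
    (Φ : Ω → StructureFunction n) (P : Measure Ω) (j : ℕ) : ℝ :=
  (∑ x ∈ Finset.univ.filter (fun x : Fin n → Bool => numWorking x = j),
    P.real {ω | Φ ω x = true}) / (n.choose j : ℝ)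

/-- The signature `s_k = φ_{n-k+1} - φ_{n-k}`, meant for `1 ≤ k ≤ n`. -/
noncomputable def signature {Ω : Type*} [MeasurableSpace Ω] {n : ℕ}
    (Φ : Ω → StructureFunction n) (P : Measure Ω) (k : ℕ) : ℝ :=
  workingProportion Φ P (n - k + 1) - workingProportion Φ P (n - k)

/-- The failure time of a system with structure function `Φ` whose components fail at the times
`τ i ∈ [0, ∞]`: the first time at which the system is not working, where component `i` works at
time `t` iff `t < τ i`. -/
noncomputable def systemFailureTime {n : ℕ} (Φ : StructureFunction n) (τ : Fin n → ℝ≥0∞) : ℝ≥0∞ :=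
  sInf {t : ℝ≥0∞ | Φ (fun i => decide (t < τ i)) = false}

/-- The proportion of the components that have failed by time `u`. -/
noncomputable def failedProportion {n : ℕ} (τ : Fin n → ℝ≥0∞) (u : ℝ≥0) : ℝ :=
  ((Finset.univ.filter fun i => τ i ≤ (u : ℝ≥0∞)).card : ℝ) / (n : ℝ)

/-! ### Lévy subordinators and the Lévy-frailty Marshall-Olkin distribution -/

/-- A real-valued Lévy process: it starts at zero, has independent and stationary increments,
and càdlàg paths. -/
structure IsLevyProcess {Ω : Type*} [MeasurableSpace Ω]
    (L : ℝ≥0 → Ω → ℝ) (P : Measure Ω) : Prop where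
  measurable : ∀ t, Measurable (L t)
  zero : ∀ᵐ ω ∂P, L 0 ω = 0
  indep_increments : HasIndepIncrements L P
  stationary_increments : ∀ s h : ℝ≥0, IdentDistrib (fun ω => L (s + h) ω - L s ω) (L h) P P
  cadlag : ∀ᵐ ω ∂P, ∀ t : ℝ≥0,
    ContinuousWithinAt (fun s => L s ω) (Set.Ici t) t ∧
      ∃ l : ℝ, Tendsto (fun s => L s ω) (𝓝[<] t) (𝓝 l)

/-- A Lévy subordinator: a Lévy process with nondecreasing paths. -/
structure IsSubordinator {Ω : Type*} [MeasurableSpace Ω]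
    (L : ℝ≥0 → Ω → ℝ) (P : Measure Ω) : Prop extends IsLevyProcess L P where
  monotone : ∀ᵐ ω ∂P, Monotone fun t => L t ω

/-- The Laplace exponent `ψ(x) = -log 𝔼 exp(-x L₁)`. -/
noncomputable def laplaceExponent {Ω : Type*} [MeasurableSpace Ω]
    (L : ℝ≥0 → Ω → ℝ) (P : Measure Ω) (x : ℝ) : ℝ :=
  -Real.log (∫ ω, Real.exp (-x * L 1 ω) ∂P)

/-- The first passage time `inf {t ≥ 0 : ℓ t > e}` of the path `ℓ` above the level `e`, equal
to `∞` if the path never exceeds that level. -/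
noncomputable def passageTime (ℓ : ℝ≥0 → ℝ) (e : ℝ) : ℝ≥0∞ :=
  ⨅ (t : ℝ≥0) (_ : e < ℓ t), (t : ℝ≥0∞)

/-- The Lévy-frailty Marshall-Olkin distribution of dimension `n` with underlying subordinator `L`:
the law of `(inf {t ≥ 0 : L_t > ε_i})_{i}`, where the triggers `ε_i` are iid standard
exponential and independent of `L`. -/
noncomputable def lfmoLaw {Ω : Type*} [MeasurableSpace Ω]
    (L : ℝ≥0 → Ω → ℝ) (P : Measure Ω) (n : ℕ) : Measure (Fin n → ℝ≥0∞) :=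
  (P.prod (Measure.pi fun _ : Fin n => expMeasure 1)).map
    fun p i => passageTime (fun t => L t p.1) (p.2 i)

end Reliability

open Reliability

/-! Write `S j` for the power sum `1 ^ (b-1) + ... + j ^ (b-1)`. The signature is the increment of
the working proportion `φ`, so it telescopes to `φ_j = S j / S n`. For exchangeable lifetimes
independent of the structure function, only the number `N_t` of working components at time `t`
matters: for every bounded measurable symmetric `h`, `𝔼[h(T); T_sys > t] = 𝔼[h(T) φ_{N_t}]`
(`setIntegral_lt_systemFailureTime`).

Given the subordinator, component `i` has failed by time `t` iff its trigger is below `L_t`, up to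
null events. The strong law for the iid triggers gives `N_t / n → exp(-L_t)` and `D_u → 1 -
exp(-L_u)`. Since `S j / S n → x ^ b` whenever `j / n → x > 0`, dominated convergence, first over
the triggers and then over `L`, yields the limit `𝔼[g(1 - exp(-L_u)) exp(-b L_t)]`.

This limit is read in two ways. For `g = 1` it is the Laplace transform of `L_t`, that is `exp(-ψ(b)
t)`. In general, `exp(-b L_t)` is the probability that an independent `Beta(1, b)` variable exceeds
`1 - exp(-L_t)`, which is the event `τ > t` up to a null set.

The convergence of `Q_n` is a weighted Riemann sum: monomials in `1 - Q_n` reduce to power sums with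
another exponent, and Weierstrass approximation covers continuous functions. -/

namespace Reliability

/-! ### Power sums -/

/-- The power sum `∑_{i = 1}^n i ^ (a - 1)`. -/
noncomputable def powerSum (a : ℝ) (n : ℕ) : ℝ :=
  ∑ i ∈ Finset.range n, ((i : ℝ) + 1) ^ (a - 1)

lemma powerSum_pos (a : ℝ) {n : ℕ} (hn : 0 < n) : 0 < powerSum a n :=
  Finset.sum_pos (fun i _ => by positivity) (by simpa using hn.ne')

lemma powerSum_nonneg (a : ℝ) (n : ℕ) : 0 ≤ powerSum a n :=
  Finset.sum_nonneg fun i _ => by positivity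

lemma powerSum_mono (a : ℝ) : Monotone (powerSum a) := fun _ _ h =>
  Finset.sum_le_sum_of_subset_of_nonneg (by simpa using h) fun _ _ _ => by positivity

/-- Scaled by `(i + 1) ^ a`, the quotient is the reciprocal of the slope of `x ^ a` between `1` and
`1 - 1 / (i + 1)`, and the derivative at `1` is `a`. -/
lemma tendsto_rpow_sub_mul_rpow {a : ℝ} (ha : 0 < a) :
    Tendsto (fun i : ℕ => ((i : ℝ) + 1) ^ (a - 1) / (((i : ℝ) + 1) ^ a - (i : ℝ) ^ a))
      atTop (𝓝 (1 / a)) := by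
  have hd : HasDerivAt (fun x : ℝ => x ^ a) a 1 := by
    simpa using Real.hasDerivAt_rpow_const (x := 1) (p := a) (Or.inl one_ne_zero)
  have hseq : Tendsto (fun i : ℕ => (1 : ℝ) - 1 / ((i : ℝ) + 1)) atTop (𝓝[≠] 1) := by
    refine tendsto_nhdsWithin_iff.2 ⟨?_, Eventually.of_forall fun i => ?_⟩
    · simpa using (tendsto_one_div_add_atTop_nhds_zero_nat (𝕜 := ℝ)).const_sub 1
    · have : 0 < 1 / ((i : ℝ) + 1) := by positivity
      simp only [Set.mem_compl_iff, Set.mem_singleton_iff]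
      linarith
  have h := ((hasDerivAt_iff_tendsto_slope.1 hd).comp hseq).inv₀ ha.ne'
  rw [one_div]
  refine h.congr fun i => ?_
  have hi : (0 : ℝ) < (i : ℝ) + 1 := by positivity
  have h1 : (1 : ℝ) - 1 / ((i : ℝ) + 1) = i / ((i : ℝ) + 1) := by field_simp; ring
  simp only [Function.comp, slope_def_field]
  have hlt : (i : ℝ) ^ a < ((i : ℝ) + 1) ^ a :=
    Real.rpow_lt_rpow (by positivity) (by linarith) ha
  have hpos : (0 : ℝ) < ((i : ℝ) + 1) ^ a := by positivity
  rw [h1, Real.div_rpow (by positivity) hi.le, Real.rpow_sub_one hi.ne', Real.one_rpow]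
  have h2 : ((i : ℝ) + 1) ^ a - (i : ℝ) ^ a ≠ 0 := by linarith
  have h3 : (i : ℝ) ^ a / ((i : ℝ) + 1) ^ a - 1 =
      -((((i : ℝ) + 1) ^ a - (i : ℝ) ^ a) / ((i : ℝ) + 1) ^ a) := by field_simp; ring
  have h4 : (i : ℝ) / ((i : ℝ) + 1) - 1 = - (1 / ((i : ℝ) + 1)) := by field_simp; ring
  rw [h3, h4, neg_div_neg_eq]
  field_simp

/-- A Stolz–Cesàro argument: the terms are asymptotic to `1 / a` times the increments of `n ^ a`,
whose sums telescope and diverge, so the error stays negligible after summation. -/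
lemma tendsto_powerSum_div {a : ℝ} (ha : 0 < a) :
    Tendsto (fun n : ℕ => powerSum a n / (n : ℝ) ^ a) atTop (𝓝 (1 / a)) := by
  set g : ℕ → ℝ := fun i => ((i : ℝ) + 1) ^ a - (i : ℝ) ^ a with hg
  have hgpos : ∀ i, 0 < g i := fun i =>
    sub_pos.2 (Real.rpow_lt_rpow (by positivity) (by linarith) ha)
  have hsum : ∀ n : ℕ, ∑ i ∈ Finset.range n, g i = (n : ℝ) ^ a := fun n => by
    have := Finset.sum_range_sub (fun i : ℕ => (i : ℝ) ^ a) n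
    simpa [hg, Real.zero_rpow ha.ne'] using this
  have hinf : Tendsto (fun n : ℕ => (n : ℝ) ^ a) atTop atTop :=
    (tendsto_rpow_atTop ha).comp tendsto_natCast_atTop_atTop
  have ho : (fun i : ℕ => ((i : ℝ) + 1) ^ (a - 1) - 1 / a * g i) =o[atTop] g := by
    rw [Asymptotics.isLittleO_iff_tendsto fun i hi => absurd hi (hgpos i).ne']
    have := (tendsto_rpow_sub_mul_rpow ha).sub_const (1 / a)
    rw [sub_self] at this
    refine this.congr fun i => ?_
    have := (hgpos i).ne'
    rw [sub_div, mul_div_cancel_right₀ _ this]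
  have hs := ho.sum_range (fun i => (hgpos i).le) (by simpa only [hsum] using hinf)
  simp only [hsum, Finset.sum_sub_distrib, ← Finset.mul_sum] at hs
  have ht := hs.tendsto_div_nhds_zero.add_const (1 / a)
  rw [zero_add] at ht
  refine ht.congr' ?_
  filter_upwards [eventually_gt_atTop 0] with n hn
  have : (0 : ℝ) < (n : ℝ) ^ a := by positivity
  rw [sub_div, mul_div_cancel_right₀ _ this.ne', sub_add_cancel, powerSum]

/-- If `j n / n → x > 0` then the proportion of the power sum up to `n` that comes from the indices
up to `j n` tends to `x ^ a`. -/
lemma tendsto_powerSum_ratio {a x : ℝ} (ha : 0 < a) (hx : 0 < x) {j : ℕ → ℕ}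
    (hj : Tendsto (fun n => (j n : ℝ) / n) atTop (𝓝 x)) :
    Tendsto (fun n => powerSum a (j n) / powerSum a n) atTop (𝓝 (x ^ a)) := by
  -- Positivity of `x` makes `j n` diverge, so the power sum asymptotics apply along `j` as well.
  have hjinf : Tendsto j atTop atTop := by
    rw [← tendsto_natCast_atTop_iff (R := ℝ)]
    have := hj.pos_mul_atTop hx (tendsto_natCast_atTop_atTop (R := ℝ))
    refine this.congr' ?_
    filter_upwards [eventually_gt_atTop 0] with n hn
    have : (0 : ℝ) < n := by exact_mod_cast hn
    field_simp
  have h1 := (tendsto_powerSum_div ha).comp hjinf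
  have h2 := (tendsto_powerSum_div ha).inv₀ (by positivity)
  have h3 : Tendsto (fun n => ((j n : ℝ) / n) ^ a) atTop (𝓝 (x ^ a)) :=
    hj.rpow_const (Or.inl hx.ne')
  have h4 := (h1.mul h3).mul h2
  have e : 1 / a * x ^ a * (1 / a)⁻¹ = x ^ a := by field_simp
  rw [e] at h4
  refine h4.congr' ?_
  filter_upwards [eventually_gt_atTop 0, hjinf.eventually_gt_atTop 0] with n hn hjn
  have hn' : (0 : ℝ) < n := by exact_mod_cast hn
  have hjn' : (0 : ℝ) < j n := by exact_mod_cast hjn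
  have := powerSum_pos a hn
  have hA : (0 : ℝ) < (n : ℝ) ^ a := by positivity
  have hB : (0 : ℝ) < (j n : ℝ) ^ a := by positivity
  simp only [Function.comp]
  rw [Real.div_rpow hjn'.le hn'.le]
  field_simp

/-! ### The distribution `Beta(1, b)` -/

lemma integral_Ioo_one_sub_rpow {r c : ℝ} (hr : 0 < r) (hc : c ≤ 1) :
    ∫ q in Set.Ioo c 1, (1 - q) ^ (r - 1) = (1 - c) ^ r / r := by
  rw [← integral_Ioc_eq_integral_Ioo, ← intervalIntegral.integral_of_le hc,
    intervalIntegral.integral_comp_sub_left (fun x : ℝ => x ^ (r - 1)) 1, sub_self,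
    integral_rpow (Or.inl (by linarith)), sub_add_cancel, Real.zero_rpow hr.ne', sub_zero]

lemma integral_betaMeasure_one {b : ℝ} (hb : 0 < b) (f : ℝ → ℝ) :
    ∫ q, f q ∂(betaMeasure 1 b) = ∫ q in Set.Ioo 0 1, b * (1 - q) ^ (b - 1) * f q := by
  have hbeta : 1 / beta 1 b = b := by
    have h := (Real.Gamma_pos_of_pos hb).ne'
    rw [beta, add_comm 1 b, Real.Gamma_add_one hb.ne', Real.Gamma_one]
    field_simp
  rw [betaMeasure, integral_withDensity_eq_integral_toReal_smul
      (by unfold betaPDF; fun_prop) (Eventually.of_forall fun q => by simp [betaPDF]),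
    ← integral_indicator measurableSet_Ioo]
  refine integral_congr_ae (Eventually.of_forall fun q => ?_)
  by_cases hq : 0 < q ∧ q < 1
  · have h1 : 0 ≤ betaPDFReal 1 b q := (betaPDFReal_pos hq.1 hq.2 one_pos hb).le
    simp only [betaPDF, ENNReal.toReal_ofReal h1, smul_eq_mul]
    rw [Set.indicator_of_mem (show q ∈ Set.Ioo 0 1 from hq), betaPDFReal, if_pos hq, hbeta]
    simp
  · rw [Set.indicator_of_notMem (show q ∉ Set.Ioo 0 1 from hq)]
    simp [betaPDF, betaPDFReal, if_neg hq]

lemma ae_betaMeasure_mem_Ioo (a b : ℝ) : ∀ᵐ q ∂(betaMeasure a b), q ∈ Set.Ioo (0 : ℝ) 1 := by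
  rw [betaMeasure, ae_withDensity_iff (by unfold betaPDF; fun_prop)]
  refine Eventually.of_forall fun q hq => ?_
  by_contra h
  exact hq (by simp [betaPDF, betaPDFReal, if_neg (show ¬ (0 < q ∧ q < 1) from h)])

instance nullSingletonClass_betaMeasure (a b : ℝ) : NullSingletonClass (betaMeasure a b) := by
  unfold betaMeasure; infer_instance

/-- This tail has the form of the limit `x ^ b` of the power sum ratios, with `x = 1 - c`; that
match is why `Beta(1, b)` appears. -/
lemma betaMeasure_one_real_Ioi {b c : ℝ} (hb : 0 < b) (h0 : 0 ≤ c) (hc : c ≤ 1) :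
    (betaMeasure 1 b).real (Set.Ioi c) = (1 - c) ^ b := by
  rw [← integral_indicator_one measurableSet_Ioi, integral_betaMeasure_one hb]
  have h : ∀ q : ℝ, b * (1 - q) ^ (b - 1) * (Set.Ioi c).indicator 1 q =
      (Set.Ioi c).indicator (fun q => b * (1 - q) ^ (b - 1)) q := fun q => by
    by_cases hq : q ∈ Set.Ioi c <;> simp [hq]
  simp_rw [h]
  rw [setIntegral_indicator measurableSet_Ioi, Set.Ioo_inter_Ioi, sup_eq_right.2 h0,
    integral_const_mul, integral_Ioo_one_sub_rpow hb hc]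
  field_simp

lemma integral_one_sub_pow_betaMeasure_one {b : ℝ} (hb : 0 < b) (p : ℕ) :
    ∫ q, (1 - q) ^ p ∂(betaMeasure 1 b) = b / (b + p) := by
  rw [integral_betaMeasure_one hb]
  have h : ∀ q ∈ Set.Ioo (0 : ℝ) 1, b * (1 - q) ^ (b - 1) * (1 - q) ^ p =
      b * (1 - q) ^ ((b + p) - 1) := fun q hq => by
    have : (0 : ℝ) < 1 - q := by linarith [hq.2]
    rw [mul_assoc, ← Real.rpow_natCast, ← Real.rpow_add this]
    ring_nf
  rw [setIntegral_congr_fun measurableSet_Ioo h, integral_const_mul,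
    integral_Ioo_one_sub_rpow (by positivity) zero_le_one]
  simp [div_eq_mul_inv]

/-! ### Weighted Riemann sums -/

lemma integrable_betaMeasure_of_continuous {b : ℝ} (hb : 0 < b) {f : ℝ → ℝ} (hf : Continuous f) :
    Integrable f (betaMeasure 1 b) := by
  have := isProbabilityMeasureBeta one_pos hb
  obtain ⟨M, hM⟩ := (isCompact_Icc (a := (0 : ℝ)) (b := 1)).exists_bound_of_continuousOn
    hf.continuousOn
  refine Integrable.of_bound hf.aestronglyMeasurable M ?_
  filter_upwards [ae_betaMeasure_mem_Ioo 1 b] with q hq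
  exact hM q ⟨hq.1.le, hq.2.le⟩

/-- The factor `(i + 1) ^ p` merges with the weight into a power sum of exponent `b + p`, so the
limit is the ratio of `1 / (b + p)` to `1 / b`, the `p`-th moment of `1 - Q`. -/
lemma tendsto_weighted_sum_pow {b : ℝ} (hb : 0 < b) (p : ℕ) :
    Tendsto (fun n : ℕ => (∑ i ∈ Finset.range n,
        ((i : ℝ) + 1) ^ (b - 1) * (((i : ℝ) + 1) / ((n : ℝ) + 1)) ^ p) / powerSum b n)
      atTop (𝓝 (∫ q, (1 - q) ^ p ∂(betaMeasure 1 b))) := by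
  rw [integral_one_sub_pow_betaMeasure_one hb]
  have hbp : 0 < b + p := by positivity
  have h1 := tendsto_powerSum_div hbp
  have h2 := (tendsto_powerSum_div hb).inv₀ (by positivity)
  have h3 := (tendsto_natCast_div_add_atTop (1 : ℝ)).pow p
  have h4 := (h1.mul h2).mul h3
  have e : 1 / (b + p) * (1 / b)⁻¹ * 1 ^ p = b / (b + p) := by field_simp; simp
  rw [e] at h4
  refine h4.congr' ?_
  filter_upwards [eventually_gt_atTop 0] with n hn
  have hn' : (0 : ℝ) < n := by exact_mod_cast hn
  have hs : (∑ i ∈ Finset.range n,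
        ((i : ℝ) + 1) ^ (b - 1) * (((i : ℝ) + 1) / ((n : ℝ) + 1)) ^ p) =
      powerSum (b + p) n / ((n : ℝ) + 1) ^ p := by
    rw [powerSum, Finset.sum_div]
    refine Finset.sum_congr rfl fun i _ => ?_
    have hi : (0 : ℝ) < (i : ℝ) + 1 := by positivity
    rw [show b + p - 1 = (b - 1) + p by ring, Real.rpow_add_natCast hi.ne', div_pow]
    ring
  have := powerSum_pos b hn
  rw [hs, Real.rpow_add_natCast hn'.ne', div_pow]
  have : (0 : ℝ) < (n : ℝ) ^ b := by positivity
  field_simp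

lemma tendsto_weighted_sum_polynomial {b : ℝ} (hb : 0 < b) (p : Polynomial ℝ) :
    Tendsto (fun n : ℕ => (∑ i ∈ Finset.range n,
        ((i : ℝ) + 1) ^ (b - 1) * p.eval (((i : ℝ) + 1) / ((n : ℝ) + 1))) / powerSum b n)
      atTop (𝓝 (∫ q, p.eval (1 - q) ∂(betaMeasure 1 b))) := by
  induction p using Polynomial.induction_on' with
  | add p q hp hq =>
    simp only [Polynomial.eval_add, mul_add, Finset.sum_add_distrib]
    simp_rw [add_div (Finset.sum _ _) (Finset.sum _ _)]
    rw [integral_add]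
    · exact hp.add hq
    · exact integrable_betaMeasure_of_continuous hb (by fun_prop)
    · exact integrable_betaMeasure_of_continuous hb (by fun_prop)
  | monomial k c =>
    simp only [Polynomial.eval_monomial, mul_left_comm _ c, ← Finset.mul_sum, mul_div_assoc,
      integral_const_mul]
    simpa only [← mul_div_assoc] using (tendsto_weighted_sum_pow hb k).const_mul c

lemma tendsto_weighted_sum {b : ℝ} (hb : 0 < b) {f : ℝ → ℝ} (hf : Continuous f) :
    Tendsto (fun n : ℕ => (∑ i ∈ Finset.range n,
        ((i : ℝ) + 1) ^ (b - 1) * f (1 - ((i : ℝ) + 1) / ((n : ℝ) + 1))) / powerSum b n)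
      atTop (𝓝 (∫ q, f q ∂(betaMeasure 1 b))) := by
  have := isProbabilityMeasureBeta one_pos hb
  rw [Metric.tendsto_atTop]
  intro ε hε
  -- Both sides average over points of `[0, 1]` with total mass one, so a uniform error `ε / 3`
  -- costs at most `ε / 3` on each side.
  obtain ⟨p, hp⟩ := exists_polynomial_near_of_continuousOn 0 1 (fun x => f (1 - x))
    (by fun_prop) (ε / 3) (by positivity)
  obtain ⟨N, hN⟩ := Metric.tendsto_atTop.1 (tendsto_weighted_sum_polynomial hb p) (ε / 3)
    (by positivity)
  refine ⟨max N 1, fun n hn => ?_⟩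
  have hn0 : 0 < n := lt_of_lt_of_le one_pos ((le_max_right _ _).trans hn)
  have hS := powerSum_pos b hn0
  have h1 := hN n ((le_max_left _ _).trans hn)
  have h2 : |∫ q, p.eval (1 - q) ∂(betaMeasure 1 b) - ∫ q, f q ∂(betaMeasure 1 b)| ≤ ε / 3 := by
    rw [← integral_sub (integrable_betaMeasure_of_continuous hb (by fun_prop))
      (integrable_betaMeasure_of_continuous hb hf), ← Real.norm_eq_abs]
    have := norm_integral_le_of_norm_le_const (μ := betaMeasure 1 b) (C := ε / 3)
      (f := fun q => p.eval (1 - q) - f q) ?_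
    · simpa using this
    · filter_upwards [ae_betaMeasure_mem_Ioo 1 b] with q hq
      have := hp (1 - q) ⟨by linarith [hq.2], by linarith [hq.1]⟩
      rw [sub_sub_cancel] at this
      exact this.le
  have h3 : |(∑ i ∈ Finset.range n,
        ((i : ℝ) + 1) ^ (b - 1) * f (1 - ((i : ℝ) + 1) / ((n : ℝ) + 1))) / powerSum b n -
      (∑ i ∈ Finset.range n,
        ((i : ℝ) + 1) ^ (b - 1) * p.eval (((i : ℝ) + 1) / ((n : ℝ) + 1))) / powerSum b n|
      ≤ ε / 3 := by
    rw [← sub_div, abs_div, abs_of_pos hS, div_le_iff₀ hS, ← Finset.sum_sub_distrib, powerSum,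
      Finset.mul_sum]
    refine (Finset.abs_sum_le_sum_abs _ _).trans (Finset.sum_le_sum fun i hi => ?_)
    have hw : (0 : ℝ) ≤ ((i : ℝ) + 1) ^ (b - 1) := by positivity
    have hin : (i : ℝ) + 1 ≤ n := by exact_mod_cast Finset.mem_range.1 hi
    rw [← mul_sub, abs_mul, abs_of_nonneg hw, mul_comm, abs_sub_comm]
    refine mul_le_mul_of_nonneg_right (hp _ ⟨by positivity, ?_⟩).le hw
    rw [div_le_one (by positivity)]
    linarith
  rw [Real.dist_eq] at h1 ⊢
  rw [abs_lt] at h1 ⊢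
  rw [abs_le] at h2 h3
  constructor <;> linarith [h1.1, h1.2, h2.1, h2.2, h3.1, h3.2]

/-! ### Configurations and structure functions -/

lemma IsMonotoneSystem.monotone {n : ℕ} {Φ : StructureFunction n} (hΦ : IsMonotoneSystem Φ) :
    Monotone Φ := by
  intro x y hxy
  -- Lower `y` to `x` one coordinate at a time; `s` collects the coordinates already changed.
  have key : ∀ s : Finset (Fin n), Φ (s.piecewise x y) ≤ Φ y := by
    intro s
    induction s using Finset.induction_on with
    | empty => simp
    | insert i s hi ih =>
      refine le_trans ?_ ih
      have h1 : s.piecewise x y = Function.update (s.piecewise x y) i (y i) := by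
        rw [eq_comm, Function.update_eq_self_iff, Finset.piecewise_eq_of_notMem _ _ _ hi]
      rw [Finset.piecewise_insert]
      conv_rhs => rw [h1]
      have := hxy i
      cases hx : x i <;> cases hy : y i
      · exact le_rfl
      · exact hΦ i _
      · rw [hx, hy] at this
        exact absurd this (by simp)
      · exact le_rfl
  simpa using key Finset.univ

/-- The configuration of the components at time `t`. -/
noncomputable def configAt {n : ℕ} (t : ℝ≥0∞) (τ : Fin n → ℝ≥0∞) : Fin n → Bool :=
  fun i => decide (t < τ i)

lemma lt_systemFailureTime_iff {n : ℕ} {Φ : StructureFunction n} (hΦ : IsMonotoneSystem Φ)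
    (τ : Fin n → ℝ≥0∞) {t : ℝ≥0∞} (ht : t ≠ ⊤) :
    t < systemFailureTime Φ τ ↔ Φ (configAt t τ) = true := by
  constructor
  · intro h
    by_contra hf
    exact absurd h (not_lt.2 (sInf_le (Bool.eq_false_iff.2 hf)))
  · intro h
    -- The next component failure after `t`, equal to `⊤` if nothing is left. There are finitely
    -- many components, so it lies strictly after `t`; before it, every component working at `t`
    -- still works.
    have hlt : t < (Finset.univ.filter fun i => t < τ i).inf τ := by
      rw [Finset.lt_inf_iff ht.lt_top]
      simp
    refine hlt.trans_le (le_sInf fun s hs => ?_)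
    by_contra! hst
    have hle : configAt t τ ≤ configAt s τ := by
      intro i
      by_cases hi : t < τ i
      · have : s < τ i := hst.trans_le (Finset.inf_le (by simpa using hi))
        simp [configAt, this]
      · simp [configAt, hi]
    have := hΦ.monotone hle
    rw [h, show Φ (configAt s τ) = false from hs] at this
    exact absurd this (by decide)

lemma measurable_configAt {n : ℕ} (t : ℝ≥0∞) : Measurable (configAt (n := n) t) := by
  refine measurable_pi_lambda _ fun i => measurable_to_bool ?_
  have : (fun τ : Fin n → ℝ≥0∞ => configAt t τ i) ⁻¹' {true} = {τ | t < τ i} := by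
    ext τ; simp [configAt]
  rw [this]
  exact measurableSet_lt measurable_const (measurable_pi_apply i)

lemma numWorking_le {n : ℕ} (x : Fin n → Bool) : numWorking x ≤ n :=
  (Finset.card_le_univ _).trans_eq (Fintype.card_fin n)

lemma card_numWorking_eq (n j : ℕ) :
    (Finset.univ.filter fun x : Fin n → Bool => numWorking x = j).card = n.choose j := by
  have h : (Finset.powersetCard j (Finset.univ : Finset (Fin n))).card = n.choose j := by simp
  rw [← h]
  refine Finset.card_bij' (fun x _ => Finset.univ.filter fun i => x i = true)
    (fun s _ i => decide (i ∈ s)) ?_ ?_ ?_ ?_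
  · intro x hx
    rw [Finset.mem_filter] at hx
    exact Finset.mem_powersetCard.2 ⟨Finset.subset_univ _, hx.2⟩
  · intro s hs
    rw [Finset.mem_powersetCard] at hs
    rw [Finset.mem_filter]
    simpa [numWorking] using hs.2
  · intro x _
    ext i
    simp
  · intro s _
    ext i
    simp

lemma exists_perm_of_numWorking_eq {n : ℕ} {x y : Fin n → Bool}
    (h : numWorking x = numWorking y) : ∃ σ : Equiv.Perm (Fin n), ∀ i, y (σ i) = x i := by
  have hc : Fintype.card {i // x i = true} = Fintype.card {i // y i = true} := by
    simpa [Fintype.card_subtype, numWorking] using h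
  let e := Fintype.equivOfCardEq hc
  refine ⟨e.extendSubtype, fun i => ?_⟩
  by_cases hi : x i = true
  · rw [hi, e.extendSubtype_mem i hi]
  · rw [Bool.eq_false_iff.2 hi, Bool.eq_false_iff]
    exact e.extendSubtype_not_mem i hi

/-! ### The reliability of a system with exchangeable components -/

lemma workingProportion_nonneg {Ω : Type*} [MeasurableSpace Ω] {P : Measure Ω} {n : ℕ}
    (Φ : Ω → StructureFunction n) (j : ℕ) :
    0 ≤ workingProportion Φ P j :=
  div_nonneg (Finset.sum_nonneg fun _ _ => measureReal_nonneg) (Nat.cast_nonneg _)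

section Exchangeable

variable {Ω : Type*} [MeasurableSpace Ω] {P : Measure Ω} [IsProbabilityMeasure P] {n : ℕ}

/-- A measure on `Fin n → E` is exchangeable if it is invariant under permutations of the
coordinates. -/
def IsExchangeable {E : Type*} [MeasurableSpace E] (ν : Measure (Fin n → E)) : Prop :=
  ∀ σ : Equiv.Perm (Fin n), ν.map (fun τ i => τ (σ i)) = ν

lemma IsExchangeable.integral_ite_configAt_eq {ν : Measure (Fin n → ℝ≥0∞)}
    (hν : IsExchangeable ν) {h : (Fin n → ℝ≥0∞) → ℝ} (hm : Measurable h)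
    (hsymm : ∀ (σ : Equiv.Perm (Fin n)) τ, h (fun i => τ (σ i)) = h τ) (t : ℝ≥0∞)
    {x y : Fin n → Bool} (hxy : numWorking x = numWorking y) :
    ∫ τ, (if configAt t τ = x then h τ else 0) ∂ν =
      ∫ τ, (if configAt t τ = y then h τ else 0) ∂ν := by
  obtain ⟨σ, hσ⟩ := exists_perm_of_numWorking_eq hxy
  have hmeas : Measurable fun τ => if configAt t τ = x then h τ else 0 :=
    Measurable.ite (measurable_configAt t (measurableSet_singleton x)) hm measurable_const
  conv_lhs => rw [← hν σ]
  rw [integral_map (measurable_pi_lambda _ fun i => measurable_pi_apply (σ i)).aemeasurable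
    hmeas.aestronglyMeasurable]
  refine integral_congr_ae (Eventually.of_forall fun τ => ?_)
  have hiff : configAt t (fun i => τ (σ i)) = x ↔ configAt t τ = y := by
    constructor
    · intro h
      funext j
      have := congrFun h (σ.symm j)
      simp only [configAt, Equiv.apply_symm_apply] at this
      rw [configAt, this, ← hσ, Equiv.apply_symm_apply]
    · intro h
      funext i
      rw [← hσ, ← h]
      rfl
  simp only [hiff, hsymm]

/-- As `a` is constant on each level of `numWorking`, `p` may be replaced by its average over the
level. With `p x` the probability that the system works in `x`, these averages are the working
proportions. -/
lemma sum_mul_eq_sum_average_mul (p a : (Fin n → Bool) → ℝ)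
    (ha : ∀ x y, numWorking x = numWorking y → a x = a y) :
    ∑ x, p x * a x = ∑ x, (∑ y ∈ Finset.univ.filter (fun y => numWorking y = numWorking x), p y) /
      (n.choose (numWorking x) : ℝ) * a x := by
  have hmap : ∀ x ∈ (Finset.univ : Finset (Fin n → Bool)),
      numWorking x ∈ Finset.range (n + 1) := fun x _ =>
    Finset.mem_range.2 (Nat.lt_succ_of_le (numWorking_le x))
  rw [← Finset.sum_fiberwise_of_maps_to hmap, ← Finset.sum_fiberwise_of_maps_to hmap]
  refine Finset.sum_congr rfl fun j hj => ?_
  have hchoose : (n.choose j : ℝ) ≠ 0 := by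
    exact_mod_cast (Nat.choose_pos (Nat.lt_succ_iff.1 (Finset.mem_range.1 hj))).ne'
  obtain ⟨z, hz⟩ : (Finset.univ.filter fun x : Fin n → Bool => numWorking x = j).Nonempty := by
    rw [← Finset.card_pos, card_numWorking_eq]
    exact Nat.choose_pos (Nat.lt_succ_iff.1 (Finset.mem_range.1 hj))
  have hz' : numWorking z = j := by simpa using hz
  have hL : ∀ x ∈ Finset.univ.filter (fun x : Fin n → Bool => numWorking x = j),
      p x * a x = p x * a z := fun x hx => by
    rw [ha x z (by rw [hz']; simpa using hx)]
  have hR : ∀ x ∈ Finset.univ.filter (fun x : Fin n → Bool => numWorking x = j),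
      (∑ y ∈ Finset.univ.filter (fun y => numWorking y = numWorking x), p y) /
        (n.choose (numWorking x) : ℝ) * a x =
      (∑ y ∈ Finset.univ.filter (fun y => numWorking y = j), p y) / (n.choose j : ℝ) * a z :=
    fun x hx => by
      have hx' : numWorking x = j := by simpa using hx
      rw [ha x z (by rw [hz', hx']), hx']
  rw [Finset.sum_congr rfl hL, Finset.sum_congr rfl hR, Finset.sum_const, card_numWorking_eq,
    ← Finset.sum_mul, nsmul_eq_mul]
  field_simp

/-- The Samaniego-type representation of the reliability of a mixed system with exchangeable
component failure times. -/
lemma setIntegral_lt_systemFailureTime {Φ : Ω → StructureFunction n} {T : Ω → Fin n → ℝ≥0∞}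
    {ν : Measure (Fin n → ℝ≥0∞)} (hΦ : IsMixedCoherent Φ P) (hT : HasLaw T ν P)
    (hindep : IndepFun Φ T P) (hν : IsExchangeable ν) {h : (Fin n → ℝ≥0∞) → ℝ}
    (hm : Measurable h) {M : ℝ} (hM : ∀ τ, ‖h τ‖ ≤ M)
    (hsymm : ∀ (σ : Equiv.Perm (Fin n)) τ, h (fun i => τ (σ i)) = h τ)
    {t : ℝ≥0∞} (ht : t ≠ ⊤) :
    ∫ ω in {ω | t < systemFailureTime (Φ ω) (T ω)}, h (T ω) ∂P =
      ∫ τ, h τ * workingProportion Φ P (numWorking (configAt t τ)) ∂ν := by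
  have hprob : IsProbabilityMeasure ν := hT.isProbabilityMeasure_iff.1 inferInstance
  have hM0 : 0 ≤ M := (norm_nonneg _).trans (hM fun _ => 0)
  set A : Set Ω := {ω | Φ ω (configAt t (T ω)) = true} with hA
  have hAe : {ω | t < systemFailureTime (Φ ω) (T ω)} =ᵐ[P] A := by
    filter_upwards [hΦ.coherent] with ω hω
    exact propext (lt_systemFailureTime_iff hω.1 (T ω) ht)
  set k : (Fin n → Bool) → (Fin n → ℝ≥0∞) → ℝ :=
    fun x τ => if configAt t τ = x then h τ else 0 with hk
  have hkm : ∀ x, Measurable (k x) := fun x =>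
    Measurable.ite (measurable_configAt t (measurableSet_singleton x)) hm measurable_const
  have hkM : ∀ x τ, ‖k x τ‖ ≤ M := fun x τ => by
    simp only [hk]; split_ifs
    · exact hM τ
    · simpa using hM0
  set d : (Fin n → Bool) → StructureFunction n → ℝ := fun x φ => if φ x = true then 1 else 0 with hd
  have hdm : ∀ x, Measurable (d x) := fun x =>
    Measurable.ite ((measurable_pi_apply (X := fun _ => Bool) x) (measurableSet_singleton true))
      measurable_const measurable_const
  have hA0 : NullMeasurableSet A P := by
    have : A = ⋃ x : Fin n → Bool, {ω | Φ ω x = true} ∩ {ω | configAt t (T ω) = x} := by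
      ext ω; simp [hA]
    rw [this]
    refine NullMeasurableSet.iUnion fun x => NullMeasurableSet.inter ?_ ?_
    · exact (((measurable_pi_apply x).comp hΦ.measurable)
        (measurableSet_singleton true)).nullMeasurableSet
    · exact ((measurable_configAt t).comp_aemeasurable hT.aemeasurable).nullMeasurableSet_preimage
        (measurableSet_singleton x)
  have hkint : ∀ x, Integrable (k x) ν := fun x =>
    Integrable.of_bound (hkm x).aestronglyMeasurable M (Eventually.of_forall (hkM x))
  have hkT : ∀ x, ∫ ω, k x (T ω) ∂P = ∫ τ, k x τ ∂ν := fun x => by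
    rw [← hT.map_eq, integral_map hT.aemeasurable (hkm x).aestronglyMeasurable]
  have hdP : ∀ x, ∫ ω, d x (Φ ω) ∂P = P.real {ω | Φ ω x = true} := fun x => by
    have hms : MeasurableSet {ω | Φ ω x = true} :=
      ((measurable_pi_apply x).comp hΦ.measurable) (measurableSet_singleton true)
    rw [← integral_indicator_one hms]
    refine integral_congr_ae (Eventually.of_forall fun ω => ?_)
    simp [hd, Set.indicator_apply]
  rw [setIntegral_congr_set hAe, ← integral_indicator₀ hA0]
  -- Splitting over the realized configuration separates the structure function from the lifetimes,
  -- so independence factors each term.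
  have hsplit : ∀ ω, A.indicator (fun ω => h (T ω)) ω = ∑ x, d x (Φ ω) * k x (T ω) := by
    intro ω
    rw [Finset.sum_eq_single (configAt t (T ω))]
    · by_cases hω : ω ∈ A
      · rw [Set.indicator_of_mem hω]
        have : Φ ω (configAt t (T ω)) = true := hω
        simp [hd, hk, this]
      · rw [Set.indicator_of_notMem hω]
        have : ¬ Φ ω (configAt t (T ω)) = true := hω
        simp [hd, this]
    · intro x _ hx
      simp [hk, hx.symm]
    · simp
  simp_rw [hsplit]
  have hint : ∀ x ∈ Finset.univ, Integrable (fun ω => d x (Φ ω) * k x (T ω)) P := fun x _ => by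
    refine Integrable.of_bound (((hdm x).comp hΦ.measurable).aestronglyMeasurable.mul
      ((hkm x).comp_aemeasurable hT.aemeasurable).aestronglyMeasurable) M
      (Eventually.of_forall fun ω => ?_)
    simp only [hd]
    split_ifs
    · simpa using hkM x (T ω)
    · simpa using hM0
  rw [integral_finsetSum _ hint]
  have hfac : ∀ x, ∫ ω, d x (Φ ω) * k x (T ω) ∂P =
      P.real {ω | Φ ω x = true} * ∫ τ, k x τ ∂ν := fun x => by
    rw [← hdP, ← hkT]
    exact (hindep.comp (hdm x) (hkm x)).integral_fun_mul_eq_mul_integral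
      ((hdm x).comp hΦ.measurable).aestronglyMeasurable
      ((hkm x).comp_aemeasurable hT.aemeasurable).aestronglyMeasurable
  simp_rw [hfac]
  rw [sum_mul_eq_sum_average_mul _ _ fun x y hxy =>
    hν.integral_ite_configAt_eq hm hsymm t hxy]
  have hrhs : ∀ τ, h τ * workingProportion Φ P (numWorking (configAt t τ)) =
      ∑ x, workingProportion Φ P (numWorking x) * k x τ := by
    intro τ
    rw [Finset.sum_eq_single (configAt t τ)]
    · simp [hk, mul_comm]
    · intro x _ hx
      simp [hk, hx.symm]
    · simp
  simp_rw [hrhs]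
  rw [integral_finsetSum _ fun x _ => (hkint x).const_mul _]
  simp_rw [integral_const_mul]
  rfl

lemma workingProportion_le_one (Φ : Ω → StructureFunction n) (j : ℕ) :
    workingProportion Φ P j ≤ 1 := by
  refine div_le_one_of_le₀ ?_ (Nat.cast_nonneg _)
  refine (Finset.sum_le_sum fun x _ => measureReal_le_one).trans ?_
  simp [card_numWorking_eq]

end Exchangeable

/-! ### First passage times -/

/-- If `ℓ v < e`, right continuity keeps the path below `e` a little beyond `v`. The tie `e = ℓ v`
is excluded: the path may exceed `e` immediately after `v` without doing so at `v`. -/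
lemma passageTime_le_iff {ℓ : ℝ≥0 → ℝ} (hmono : Monotone ℓ) {v : ℝ≥0}
    (hcont : ContinuousWithinAt ℓ (Set.Ici v) v) {e : ℝ} (he : e ≠ ℓ v) :
    passageTime ℓ e ≤ v ↔ e < ℓ v := by
  constructor
  · intro h
    by_contra! hle
    have hlt : ℓ v < e := lt_of_le_of_ne hle he.symm
    have hev : ∀ᶠ s in 𝓝[≥] v, ℓ s < e := hcont.eventually (gt_mem_nhds hlt)
    obtain ⟨w, hvw, hw⟩ := (mem_nhdsGE_iff_exists_Ico_subset).1 hev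
    have : (w : ℝ≥0∞) ≤ passageTime ℓ e := by
      refine le_iInf₂ fun s hs => ?_
      by_contra! hsw
      have hsw' : s < w := by exact_mod_cast hsw
      rcases le_total v s with hvs | hvs
      · exact absurd hs (not_lt.2 (hw ⟨hvs, hsw'⟩ : ℓ s < e).le)
      · exact absurd (hs.trans_le (hmono hvs)) (not_lt.2 hlt.le)
    exact absurd (this.trans h) (not_le.2 (by exact_mod_cast hvw))
  · intro h
    exact iInf₂_le v h

/-- A countable infimum, which gives measurability. By monotonicity, rational times just after a
time of exceedance also exceed; negative rationals only repeat the time `0`. -/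
lemma passageTime_eq_iInf_rat {ℓ : ℝ≥0 → ℝ} (hmono : Monotone ℓ) (e : ℝ) :
    passageTime ℓ e =
      ⨅ q : ℚ, if e < ℓ (Real.toNNReal q) then (Real.toNNReal q : ℝ≥0∞) else ⊤ := by
  refine le_antisymm ?_ ?_
  · rw [le_iInf_iff]
    intro q
    split_ifs with h
    · exact iInf₂_le (Real.toNNReal q) h
    · exact le_top
  · refine le_iInf₂ fun s hs => le_of_forall_gt_imp_ge_of_dense fun y (hy : (s : ℝ≥0∞) < y) => ?_
    obtain ⟨q, -, hsq, hqy⟩ := ENNReal.lt_iff_exists_rat_btwn.1 hy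
    have hsq' : s < Real.toNNReal q := by exact_mod_cast hsq
    refine (iInf_le _ q).trans ?_
    rw [if_pos (hs.trans_le (hmono hsq'.le))]
    exact hqy.le

section Subordinator

variable {Ω : Type*} [MeasurableSpace Ω] {P : Measure Ω} {L : ℝ≥0 → Ω → ℝ}

lemma IsSubordinator.ae_path (hL : IsSubordinator L P) :
    ∀ᵐ ω ∂P, (Monotone fun t => L t ω) ∧ (∀ t, 0 ≤ L t ω) ∧
      ∀ v, ContinuousWithinAt (fun s => L s ω) (Set.Ici v) v := by
  filter_upwards [hL.monotone, hL.cadlag, hL.zero] with ω h1 h2 h3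
  exact ⟨h1, fun t => h3 ▸ h1 zero_le, fun v => (h2 v).1⟩

instance isProbabilityMeasure_expMeasure_one : IsProbabilityMeasure (expMeasure 1) :=
  isProbabilityMeasure_expMeasure one_pos

instance nullSingletonClass_expMeasure (r : ℝ) : NullSingletonClass (expMeasure r) := by
  unfold expMeasure gammaMeasure; infer_instance

lemma expMeasure_real_Iio {r c : ℝ} (hr : 0 < r) (hc : 0 ≤ c) :
    (expMeasure r).real (Set.Iio c) = 1 - Real.exp (-(r * c)) := by
  have := isProbabilityMeasure_expMeasure hr
  rw [measureReal_congr Iio_ae_eq_Iic, ← cdf_eq_real, cdf_expMeasure_eq hr, if_pos hc]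

lemma expMeasure_real_Ioi {r c : ℝ} (hr : 0 < r) (hc : 0 ≤ c) :
    (expMeasure r).real (Set.Ioi c) = Real.exp (-(r * c)) := by
  have := isProbabilityMeasure_expMeasure hr
  rw [← Set.compl_Iic, probReal_compl_eq_one_sub measurableSet_Iic, ← cdf_eq_real,
    cdf_expMeasure_eq hr, if_pos hc, sub_sub_cancel]

lemma IsSubordinator.aemeasurable_passageTime (hL : IsSubordinator L P) (n : ℕ) :
    AEMeasurable (fun (p : Ω × (Fin n → ℝ)) i => passageTime (fun t => L t p.1) (p.2 i))
      (P.prod (Measure.pi fun _ : Fin n => expMeasure 1)) := by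
  refine ⟨fun p i => ⨅ q : ℚ, if p.2 i < L (Real.toNNReal q) p.1 then
    (Real.toNNReal q : ℝ≥0∞) else ⊤, ?_, ?_⟩
  · refine measurable_pi_lambda _ fun i => Measurable.iInf fun q => ?_
    refine Measurable.ite (measurableSet_lt (by fun_prop) ?_) measurable_const measurable_const
    exact (hL.measurable _).comp measurable_fst
  · filter_upwards [Measure.quasiMeasurePreserving_fst.ae hL.ae_path] with p hp
    funext i
    exact passageTime_eq_iInf_rat hp.1 _

lemma IsSubordinator.ae_passageTime_le_iff (hL : IsSubordinator L P) (n : ℕ) (v : ℝ≥0) :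
    ∀ᵐ p ∂(P.prod (Measure.pi fun _ : Fin n => expMeasure 1)),
      ∀ i, passageTime (fun t => L t p.1) (p.2 i) ≤ v ↔ p.2 i < L v p.1 := by
  have hLv := hL.measurable v
  have hne : ∀ᵐ p ∂(P.prod (Measure.pi fun _ : Fin n => expMeasure 1)),
      ∀ i, p.2 i ≠ L v p.1 := by
    rw [ae_all_iff]
    intro i
    rw [Measure.ae_prod_iff_ae_ae]
    · refine Eventually.of_forall fun ω => ?_
      have := (measurePreserving_eval (fun _ : Fin n => expMeasure 1) i).quasiMeasurePreserving.ae
        ((Set.countable_singleton (L v ω)).ae_notMem _)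
      simpa using this
    · exact (measurableSet_eq_fun (by fun_prop) (by fun_prop)).compl
  filter_upwards [Measure.quasiMeasurePreserving_fst.ae hL.ae_path, hne] with p hp hp' i
  exact passageTime_le_iff hp.1 (hp.2.2 v) (hp' i)

/-- Permuting the lifetimes amounts to permuting the iid triggers with `L` held fixed. -/
lemma isExchangeable_lfmoLaw [IsProbabilityMeasure P] (hL : IsSubordinator L P) (n : ℕ) :
    IsExchangeable (lfmoLaw L P n) := by
  intro σ
  have hσ : MeasurePreserving (fun (e : Fin n → ℝ) i => e (σ i))
      (Measure.pi fun _ => expMeasure 1) (Measure.pi fun _ => expMeasure 1) := by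
    refine ⟨measurable_pi_lambda _ fun i => measurable_pi_apply (σ i), ?_⟩
    rw [← Measure.infinitePi_eq_pi]
    exact Measure.map_infinitePi_infinitePi_of_inj (P := fun _ : Fin n => expMeasure 1) σ.injective
  have hprod := (MeasurePreserving.id P).prod hσ
  have hF := hL.aemeasurable_passageTime n
  have hperm : Measurable fun (τ : Fin n → ℝ≥0∞) i => τ (σ i) :=
    measurable_pi_lambda _ fun i => measurable_pi_apply (σ i)
  conv_rhs => rw [lfmoLaw, ← hprod.map_eq, AEMeasurable.map_map_of_aemeasurable
    (by rwa [hprod.map_eq]) hprod.measurable.aemeasurable]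
  rw [lfmoLaw, AEMeasurable.map_map_of_aemeasurable hperm.aemeasurable hF]
  rfl

end Subordinator

/-! ### Laws of large numbers for exponential triggers -/

lemma ae_tendsto_card_lt_div {c : ℝ} (hc : 0 ≤ c) :
    ∀ᵐ e ∂(Measure.infinitePi fun _ : ℕ => expMeasure 1),
      Tendsto (fun n : ℕ => ((Finset.univ.filter fun i : Fin n => e i < c).card : ℝ) / n)
        atTop (𝓝 (1 - Real.exp (-c))) := by
  set μ := Measure.infinitePi fun _ : ℕ => expMeasure 1 with hμ
  set φ : ℝ → ℝ := (Set.Iio c).indicator 1 with hφ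
  have hφm : Measurable φ := measurable_one.indicator measurableSet_Iio
  have hind : iIndepFun (fun (i : ℕ) (e : ℕ → ℝ) => φ (e i)) μ :=
    iIndepFun_infinitePi (X := fun _ => φ) fun _ => hφm
  have hint : Integrable (fun e : ℕ → ℝ => φ (e 0)) μ := by
    refine Integrable.of_bound (hφm.comp (measurable_pi_apply 0)).aestronglyMeasurable 1 (Eventually.of_forall fun e => ?_)
    exact (norm_indicator_le_norm_self _ _).trans (by simp)
  have hmean : ∫ e : ℕ → ℝ, φ (e 0) ∂μ = 1 - Real.exp (-c) := by
    have h := (measurePreserving_eval_infinitePi (fun _ : ℕ => expMeasure 1) 0)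
    have h2 := integral_map (μ := μ) h.measurable.aemeasurable (f := φ) hφm.aestronglyMeasurable
    rw [hμ, h.map_eq, hφ, integral_indicator_one measurableSet_Iio, expMeasure_real_Iio one_pos hc,
      one_mul] at h2
    rw [hμ]
    exact h2.symm
  have hid : ∀ i, IdentDistrib (fun e : ℕ → ℝ => φ (e i)) (fun e => φ (e 0)) μ μ := fun i => by
    have hi : IdentDistrib (fun e : ℕ → ℝ => e i) (fun e => e 0) μ μ := by
      refine ⟨(measurable_pi_apply i).aemeasurable, (measurable_pi_apply 0).aemeasurable, ?_⟩
      rw [hμ, Measure.infinitePi_map_eval, Measure.infinitePi_map_eval]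
    exact hi.comp hφm
  have := strong_law_ae_real _ hint (fun i j hij => hind.indepFun hij) hid
  rw [hmean] at this
  filter_upwards [this] with e he
  refine he.congr fun n => ?_
  rw [Finset.sum_range, Finset.card_filter]
  push_cast
  simp [hφ, Set.indicator_apply]

/-- Places the triggers of all systems on one probability space, where the strong law can be
combined with dominated convergence. -/
lemma integral_pi_eq_integral_infinitePi (n : ℕ) {f : (Fin n → ℝ) → ℝ} (hf : Measurable f) :
    ∫ e, f e ∂(Measure.pi fun _ : Fin n => expMeasure 1) =
      ∫ e : ℕ → ℝ, f (fun i => e i) ∂(Measure.infinitePi fun _ => expMeasure 1) := by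
  rw [← Measure.infinitePi_eq_pi, ← Measure.map_infinitePi_infinitePi_of_inj
    (P := fun _ : ℕ => expMeasure 1) Fin.val_injective, integral_map
    (measurable_pi_lambda _ fun i => measurable_pi_apply _).aemeasurable hf.aestronglyMeasurable]

/-! ### The Laplace transform of a subordinator -/

/-- Cauchy's equation, with monotonicity in place of continuity: `n * t` lies between consecutive
integers, which pins `f t` to within `|f 1| / n`. -/
lemma antitone_additive_eq_mul {f : ℝ≥0 → ℝ} (hf : Antitone f)
    (hadd : ∀ s t, f (s + t) = f s + f t) (t : ℝ≥0) : f t = t * f 1 := by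
  have h0 : f 0 = 0 := by simpa using hadd 0 0
  have hmul : ∀ (n : ℕ) (s : ℝ≥0), f (n * s) = n * f s := by
    intro n s
    induction n with
    | zero => simp [h0]
    | succ n ih => rw [Nat.cast_succ, add_mul, hadd, ih, one_mul]; push_cast; ring
  have hnat : ∀ n : ℕ, f n = n * f 1 := fun n => by simpa using hmul n 1
  have h1 : Tendsto (fun n : ℕ => (⌊(t : ℝ) * n⌋₊ : ℝ) / n * f 1) atTop (𝓝 (t * f 1)) :=
    ((tendsto_nat_floor_mul_div_atTop t.coe_nonneg).comp
      (tendsto_natCast_atTop_atTop (R := ℝ))).mul_const _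
  have h2 : Tendsto (fun n : ℕ => (⌊(t : ℝ) * n⌋₊ : ℝ) / n * f 1 + f 1 * (1 / n)) atTop
      (𝓝 (t * f 1)) := by
    simpa using h1.add (tendsto_one_div_atTop_nhds_zero_nat.const_mul (f 1))
  refine le_antisymm (ge_of_tendsto h1 ?_) (le_of_tendsto h2 ?_)
  · filter_upwards [eventually_gt_atTop 0] with n hn
    have hn' : (0 : ℝ) < n := by exact_mod_cast hn
    have hle : ((⌊(t : ℝ) * n⌋₊ : ℕ) : ℝ≥0) ≤ n * t := by
      rw [← NNReal.coe_le_coe]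
      push_cast
      rw [mul_comm]
      exact Nat.floor_le (by positivity)
    have := hf hle
    rw [hmul, hnat] at this
    rw [div_mul_eq_mul_div, le_div_iff₀ hn']
    linarith
  · filter_upwards [eventually_gt_atTop 0] with n hn
    have hn' : (0 : ℝ) < n := by exact_mod_cast hn
    have hle : (n : ℝ≥0) * t ≤ ((⌊(t : ℝ) * n⌋₊ + 1 : ℕ) : ℝ≥0) := by
      rw [← NNReal.coe_le_coe]
      push_cast
      rw [mul_comm]
      exact (Nat.lt_floor_add_one _).le
    have := hf hle
    rw [hmul, hnat] at this
    push_cast at this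
    have e : (⌊(t : ℝ) * n⌋₊ : ℝ) / n * f 1 + f 1 * (1 / n) =
        ((⌊(t : ℝ) * n⌋₊ : ℝ) + 1) * f 1 / n := by ring
    rw [e, div_le_iff₀ hn']
    linarith

section Laplace

variable {Ω : Type*} [MeasurableSpace Ω] {P : Measure Ω} {L : ℝ≥0 → Ω → ℝ}

lemma IsSubordinator.ae_nonneg (hL : IsSubordinator L P) (t : ℝ≥0) : ∀ᵐ ω ∂P, 0 ≤ L t ω := by
  filter_upwards [hL.monotone, hL.zero] with ω h1 h3
  exact h3 ▸ h1 zero_le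

lemma IsSubordinator.integrable_exp [IsProbabilityMeasure P] (hL : IsSubordinator L P) {b : ℝ} (hb : 0 ≤ b) (t : ℝ≥0) :
    Integrable (fun ω => Real.exp (-b * L t ω)) P := by
  have := hL.measurable t
  refine Integrable.of_bound (by fun_prop) 1 ?_
  filter_upwards [hL.ae_nonneg t] with ω hω
  rw [Real.norm_eq_abs, Real.abs_exp, Real.exp_le_one_iff]
  nlinarith

lemma IsSubordinator.integral_exp_pos [IsProbabilityMeasure P] (hL : IsSubordinator L P) {b : ℝ} (hb : 0 ≤ b) (t : ℝ≥0) :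
    0 < ∫ ω, Real.exp (-b * L t ω) ∂P :=
  MeasureTheory.integral_exp_pos (hL.integrable_exp hb t)

lemma IsSubordinator.integral_exp_add (hL : IsSubordinator L P) (b : ℝ) (s t : ℝ≥0) :
    ∫ ω, Real.exp (-b * L (s + t) ω) ∂P =
      (∫ ω, Real.exp (-b * L s ω) ∂P) * ∫ ω, Real.exp (-b * L t ω) ∂P := by
  have hs := hL.measurable s
  have ht := hL.measurable t
  have hst := hL.measurable (s + t)
  have hm : Measurable fun x : ℝ => Real.exp (-b * x) := by fun_prop
  have hind := (hL.indep_increments.indepFun_eval_sub (zero_le (a := s))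
    (le_self_add : s ≤ s + t) hL.zero).comp hm hm
  have h := hind.integral_fun_mul_eq_mul_integral (by fun_prop) (by fun_prop)
  have hstat := ((hL.stationary_increments s t).comp hm).integral_eq
  simp only [Function.comp_def, Pi.sub_apply] at h hstat
  rw [← hstat, ← h]
  refine integral_congr_ae (Eventually.of_forall fun ω => ?_)
  simp only [← Real.exp_add]
  ring_nf

/-- The Laplace transform of a subordinator at time `t`. -/
lemma IsSubordinator.integral_exp_eq [IsProbabilityMeasure P] (hL : IsSubordinator L P) {b : ℝ} (hb : 0 ≤ b) (t : ℝ≥0) :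
    ∫ ω, Real.exp (-b * L t ω) ∂P = Real.exp (-laplaceExponent L P b * t) := by
  -- Independent stationary increments make the log-Laplace transform additive in time;
  -- nondecreasing paths make it antitone.
  have h := antitone_additive_eq_mul (f := fun s => Real.log (∫ ω, Real.exp (-b * L s ω) ∂P))
    (fun s t hst => Real.log_le_log (hL.integral_exp_pos hb t)
      (integral_mono_ae (hL.integrable_exp hb t) (hL.integrable_exp hb s) (by
        filter_upwards [hL.monotone] with ω hω
        exact Real.exp_le_exp.2 (mul_le_mul_of_nonpos_left (hω hst) (neg_nonpos.2 hb)))))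
    (fun s t => by
      rw [hL.integral_exp_add, Real.log_mul (hL.integral_exp_pos hb s).ne'
        (hL.integral_exp_pos hb t).ne']) t
  rw [← Real.exp_log (hL.integral_exp_pos hb t), h, laplaceExponent, neg_neg, mul_comm]

/-- If `𝔼 exp(-b L_1)` were `1`, the nonnegative variable `1 - exp(-b L_1)` would have mean zero and
so vanish almost surely. -/
lemma IsSubordinator.laplaceExponent_pos [IsProbabilityMeasure P] (hL : IsSubordinator L P) {b : ℝ} (hb : 0 < b)
    (h : ¬ ∀ᵐ ω ∂P, L 1 ω = 0) : 0 < laplaceExponent L P b := by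
  refine neg_pos.2 (Real.log_neg (hL.integral_exp_pos hb.le 1) ?_)
  have hint := hL.integrable_exp hb.le 1
  have hnn : 0 ≤ᵐ[P] fun ω => 1 - Real.exp (-b * L 1 ω) := by
    filter_upwards [hL.ae_nonneg 1] with ω hω
    simp only [Pi.zero_apply, sub_nonneg, Real.exp_le_one_iff]
    nlinarith
  have hsub : ∫ ω, (1 - Real.exp (-b * L 1 ω)) ∂P = 1 - ∫ ω, Real.exp (-b * L 1 ω) ∂P := by
    rw [integral_sub (integrable_const _) hint]; simp
  have hge : 0 ≤ ∫ ω, (1 - Real.exp (-b * L 1 ω)) ∂P := integral_nonneg_of_ae hnn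
  refine lt_of_le_of_ne (by linarith) fun heq => h ?_
  have hz := (integral_eq_zero_iff_of_nonneg_ae hnn ((integrable_const _).sub hint)).1
    (by rw [hsub, heq, sub_self])
  filter_upwards [hz] with ω hω
  have h1 : Real.exp (-b * L 1 ω) = 1 := by
    have : 1 - Real.exp (-b * L 1 ω) = 0 := hω
    linarith
  have h2 := Real.exp_eq_one_iff _ |>.1 h1
  rcases mul_eq_zero.1 h2 with h3 | h3
  · linarith
  · exact h3

end Laplace

/-! ### Signatures proportional to a power -/

lemma workingProportion_eq_powerSum_div {Ω : Type*} [MeasurableSpace Ω] {P : Measure Ω}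
    [IsProbabilityMeasure P] {n : ℕ} {Φ : Ω → StructureFunction n} {b C : ℝ}
    (hC : C * powerSum b n = 1)
    (hsig : ∀ k ∈ Finset.Icc 1 n, signature Φ P k = C * ((n : ℝ) - k + 1) ^ (b - 1))
    {j : ℕ} (hj : j ≤ n) : workingProportion Φ P j = powerSum b j / powerSum b n := by
  have htel : ∀ j ≤ n, workingProportion Φ P j - workingProportion Φ P 0 = C * powerSum b j := by
    intro j hj
    rw [← Finset.sum_range_sub, powerSum, Finset.mul_sum]
    refine Finset.sum_congr rfl fun i hi => ?_
    have hi' : i < n := (Finset.mem_range.1 hi).trans_le hj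
    have h := hsig (n - i) (Finset.mem_Icc.2 ⟨by omega, by omega⟩)
    rw [signature, show n - (n - i) = i by omega, Nat.cast_sub hi'.le, sub_sub_cancel] at h
    exact h
  -- The signature sums to one, so `φ_n - φ_0 = 1` with both values in `[0, 1]`; this forces `φ_0 =
  -- 0`.
  have h0 : workingProportion Φ P 0 = 0 := by
    have := htel n le_rfl
    linarith [workingProportion_nonneg (P := P) Φ 0, workingProportion_le_one (P := P) Φ n]
  have hS : powerSum b n ≠ 0 := fun h => by simp [h] at hC
  have := htel j hj
  rw [h0, sub_zero] at this
  rw [this, eq_div_iff hS, mul_right_comm, hC, one_mul]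

lemma sum_Icc_rpow_eq_powerSum (b : ℝ) (n : ℕ) (f : ℕ → ℝ) :
    ∑ k ∈ Finset.Icc 1 n, ((n : ℝ) - k + 1) ^ (b - 1) * f k =
      ∑ i ∈ Finset.range n, ((i : ℝ) + 1) ^ (b - 1) * f (n - i) := by
  refine Finset.sum_bij' (fun k _ => n - k) (fun i _ => n - i) ?_ ?_ ?_ ?_ ?_
  · intro k hk; simp only [Finset.mem_Icc, Finset.mem_range] at *; omega
  · intro k hk; simp only [Finset.mem_Icc, Finset.mem_range] at *; omega
  · intro k hk; rw [Finset.mem_Icc] at hk; omega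
  · intro k hk; rw [Finset.mem_range] at hk; omega
  · intro k hk
    rw [Finset.mem_Icc] at hk
    rw [Nat.cast_sub hk.2, show n - (n - k) = k by omega]

/-! ### The limit of the system failure time -/

/-- If component `i` has failed by time `t` iff `e i < c`, then the working components are those
whose trigger is not below `c`. -/
lemma numWorking_configAt_eq {n : ℕ} {τ : Fin n → ℝ≥0∞} {e : Fin n → ℝ} {t : ℝ≥0∞} {c : ℝ}
    (h : ∀ i, τ i ≤ t ↔ e i < c) :
    numWorking (configAt t τ) = n - (Finset.univ.filter fun i => e i < c).card := by
  have hc := Finset.card_filter_add_card_filter_not (s := (Finset.univ : Finset (Fin n)))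
    (fun i => e i < c)
  rw [Finset.card_univ, Fintype.card_fin] at hc
  have : numWorking (configAt t τ) = (Finset.univ.filter fun i => ¬ e i < c).card := by
    unfold numWorking
    congr 1
    ext i
    simp [configAt, ← h]
  omega

/-- The product of a function `g` of the proportions of triggers below the levels `c j` and of the
proportion of the power sum that corresponds to the triggers that are not below the level `s`. -/
noncomputable def triggerFunctional (b : ℝ) {m n : ℕ} (g : (Fin m → ℝ) →ᵇ ℝ) (c : Fin m → ℝ) (s : ℝ)
    (e : Fin n → ℝ) : ℝ :=
  g (fun j => ((Finset.univ.filter fun i => e i < c j).card : ℝ) / n) *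
    (powerSum b (n - (Finset.univ.filter fun i => e i < s).card) / powerSum b n)

lemma norm_triggerFunctional_le (b : ℝ) {m n : ℕ} (g : (Fin m → ℝ) →ᵇ ℝ) (c : Fin m → ℝ) (s : ℝ)
    (e : Fin n → ℝ) : ‖triggerFunctional b g c s e‖ ≤ ‖g‖ := by
  rw [triggerFunctional, norm_mul,
    Real.norm_of_nonneg (div_nonneg (powerSum_nonneg _ _) (powerSum_nonneg _ _))]
  exact (mul_le_of_le_one_right (norm_nonneg _) (div_le_one_of_le₀
    (powerSum_mono b (Nat.sub_le _ _)) (powerSum_nonneg _ _))).trans (g.norm_coe_le_norm _)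

lemma measurable_card_filter_lt {α : Type*} [MeasurableSpace α] {n : ℕ} {e : α → Fin n → ℝ}
    {c : α → ℝ} (he : Measurable e) (hc : Measurable c) :
    Measurable fun x => (Finset.univ.filter fun i => e x i < c x).card := by
  simp_rw [Finset.card_filter]
  refine Finset.measurable_sum _ fun i _ => ?_
  exact Measurable.ite (measurableSet_lt (he.eval (a := i)) hc) measurable_const measurable_const

lemma measurable_triggerFunctional (b : ℝ) {α : Type*} [MeasurableSpace α] {m n : ℕ}
    (g : (Fin m → ℝ) →ᵇ ℝ) {c : α → Fin m → ℝ} {s : α → ℝ} {e : α → Fin n → ℝ}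
    (hc : ∀ j, Measurable fun x => c x j) (hs : Measurable s) (he : Measurable e) :
    Measurable fun x => triggerFunctional b g (c x) (s x) (e x) := by
  refine Measurable.mul (g.continuous.measurable.comp (measurable_pi_lambda _ fun j => ?_)) ?_
  · exact (measurable_from_nat.comp (measurable_card_filter_lt he (hc j))).div_const _
  · exact ((measurable_from_nat (f := fun k => powerSum b (n - k))).comp
      (measurable_card_filter_lt he hs)).div_const _

lemma tendsto_integral_pi_exp {b : ℝ} (hb : 0 < b) {m : ℕ} (g : (Fin m → ℝ) →ᵇ ℝ)
    {c : Fin m → ℝ} (hc : ∀ j, 0 ≤ c j) {s : ℝ} (hs : 0 ≤ s) :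
    Tendsto (fun n : ℕ => ∫ e : Fin n → ℝ, triggerFunctional b g c s e
        ∂(Measure.pi fun _ => expMeasure 1))
      atTop (𝓝 (g (fun j => 1 - Real.exp (-c j)) * Real.exp (-s) ^ b)) := by
  have hmeas : ∀ n, Measurable fun e : Fin n → ℝ => triggerFunctional b g c s e := fun n =>
    measurable_triggerFunctional b g (fun j => measurable_const) measurable_const measurable_id
  simp_rw [fun n => integral_pi_eq_integral_infinitePi n (hmeas n)]
  have hlim : g (fun j => 1 - Real.exp (-c j)) * Real.exp (-s) ^ b =
      ∫ _ : ℕ → ℝ, g (fun j => 1 - Real.exp (-c j)) * Real.exp (-s) ^ b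
        ∂(Measure.infinitePi fun _ => expMeasure 1) := by simp
  rw [hlim]
  refine tendsto_integral_of_dominated_convergence (fun _ => ‖g‖)
    (fun n => ((hmeas n).comp (measurable_pi_lambda _ fun i =>
      measurable_pi_apply _)).aestronglyMeasurable) (integrable_const _) (fun n => ?_) ?_
  · exact Eventually.of_forall fun e => norm_triggerFunctional_le _ _ _ _ _
  · have hall : ∀ᵐ e ∂(Measure.infinitePi fun _ : ℕ => expMeasure 1), ∀ j : Fin m,
        Tendsto (fun n : ℕ => ((Finset.univ.filter fun i : Fin n => e i < c j).card : ℝ) / n)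
          atTop (𝓝 (1 - Real.exp (-c j))) := ae_all_iff.2 fun j => ae_tendsto_card_lt_div (hc j)
    filter_upwards [hall, ae_tendsto_card_lt_div hs] with e he hes
    refine Tendsto.mul ?_ ?_
    · exact (g.continuous.tendsto _).comp (tendsto_pi_nhds.2 he)
    -- The limiting proportion `exp(-s)` of working components is positive.
    · refine tendsto_powerSum_ratio hb (Real.exp_pos _) ?_
      have := hes.const_sub 1
      rw [sub_sub_cancel] at this
      refine this.congr' ?_
      filter_upwards [eventually_gt_atTop 0] with n hn
      have hn' : (n : ℝ) ≠ 0 := by exact_mod_cast hn.ne'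
      have hcard : (Finset.univ.filter fun i : Fin n => e i < s).card ≤ n :=
        (Finset.card_le_univ _).trans_eq (Fintype.card_fin n)
      rw [Nat.cast_sub hcard, sub_div, div_self hn']

lemma measurable_failedProportion {n : ℕ} (u : ℝ≥0) :
    Measurable fun τ : Fin n → ℝ≥0∞ => failedProportion τ u := by
  unfold failedProportion
  simp_rw [Finset.card_filter]
  push_cast
  refine (Finset.measurable_sum _ fun i _ => ?_).div_const _
  exact Measurable.ite (measurableSet_le (measurable_pi_apply i) measurable_const)
    measurable_const measurable_const

lemma failedProportion_comp_perm {n : ℕ} (τ : Fin n → ℝ≥0∞) (σ : Equiv.Perm (Fin n)) (u : ℝ≥0) :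
    failedProportion (fun i => τ (σ i)) u = failedProportion τ u := by
  unfold failedProportion
  congr 2
  refine Finset.card_bij (fun i _ => σ i) (by simp) (by simp) fun j hj => ⟨σ.symm j, ?_⟩
  simpa using hj

section Limit

variable {Ω : Type*} [MeasurableSpace Ω] {P : Measure Ω} [IsProbabilityMeasure P]
  {L : ℝ≥0 → Ω → ℝ}

/-- The joint law of the failure time and the proportions of failed components, in terms of the
subordinator and the exponential triggers. -/
lemma setIntegral_lt_systemFailureTime_lfmo (hL : IsSubordinator L P)
    {Ω' : Type*} [MeasurableSpace Ω'] {P' : Measure Ω'} [IsProbabilityMeasure P'] {n : ℕ}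
    {Φ : Ω' → StructureFunction n} {T : Ω' → Fin n → ℝ≥0∞} (hΦ : IsMixedCoherent Φ P')
    (hT : HasLaw T (lfmoLaw L P n) P') (hindep : IndepFun Φ T P') {b C : ℝ}
    (hC : C * powerSum b n = 1)
    (hsig : ∀ k ∈ Finset.Icc 1 n, signature Φ P' k = C * ((n : ℝ) - k + 1) ^ (b - 1))
    {m : ℕ} (u : Fin m → ℝ≥0) (g : (Fin m → ℝ) →ᵇ ℝ) (t : ℝ≥0) :
    ∫ ω in {ω | (t : ℝ≥0∞) < systemFailureTime (Φ ω) (T ω)},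
        g (fun j => failedProportion (T ω) (u j)) ∂P' =
      ∫ ω, ∫ e : Fin n → ℝ,
        triggerFunctional b g (fun j => L (u j) ω) (L t ω) e ∂(Measure.pi fun _ => expMeasure 1) ∂P := by
  have hgm : Measurable fun τ : Fin n → ℝ≥0∞ => g (fun j => failedProportion τ (u j)) :=
    g.continuous.measurable.comp (measurable_pi_lambda _ fun j => measurable_failedProportion (u j))
  have hwm : Measurable fun τ : Fin n → ℝ≥0∞ =>
      workingProportion Φ P' (numWorking (configAt t τ)) :=
    (measurable_of_countable fun x : Fin n → Bool => workingProportion Φ P' (numWorking x)).comp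
      (measurable_configAt t)
  rw [setIntegral_lt_systemFailureTime hΦ hT hindep (isExchangeable_lfmoLaw hL n) hgm
    (fun τ => g.norm_coe_le_norm _) (fun σ τ => by simp only [failedProportion_comp_perm])
    ENNReal.coe_ne_top, lfmoLaw, integral_map (hL.aemeasurable_passageTime n)
    (Measurable.fun_mul hgm hwm).aestronglyMeasurable]
  have hint : Integrable (fun p : Ω × (Fin n → ℝ) =>
      triggerFunctional b g (fun j => L (u j) p.1) (L t p.1) p.2)
      (P.prod (Measure.pi fun _ => expMeasure 1)) :=
    Integrable.of_bound (measurable_triggerFunctional b g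
      (fun j => (hL.measurable (u j)).comp measurable_fst)
      ((hL.measurable t).comp measurable_fst) measurable_snd).aestronglyMeasurable ‖g‖
      (Eventually.of_forall fun p => norm_triggerFunctional_le _ _ _ _ _)
  rw [← integral_prod _ hint]
  refine integral_congr_ae ?_
  have hall : ∀ᵐ p ∂(P.prod (Measure.pi fun _ : Fin n => expMeasure 1)), ∀ j i,
      passageTime (fun t => L t p.1) (p.2 i) ≤ u j ↔ p.2 i < L (u j) p.1 :=
    ae_all_iff.2 fun j => hL.ae_passageTime_le_iff n (u j)
  filter_upwards [hall, hL.ae_passageTime_le_iff n t] with p hp hpt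
  rw [numWorking_configAt_eq hpt, workingProportion_eq_powerSum_div hC hsig (Nat.sub_le _ _)]
  simp only [failedProportion, hp, triggerFunctional]

lemma tendsto_integral_subordinator (hL : IsSubordinator L P) {b : ℝ} (hb : 0 < b) {m : ℕ}
    (u : Fin m → ℝ≥0) (g : (Fin m → ℝ) →ᵇ ℝ) (t : ℝ≥0) :
    Tendsto (fun n : ℕ => ∫ ω, ∫ e : Fin n → ℝ,
        triggerFunctional b g (fun j => L (u j) ω) (L t ω) e ∂(Measure.pi fun _ => expMeasure 1) ∂P)
      atTop (𝓝 (∫ ω, g (fun j => 1 - Real.exp (-L (u j) ω)) * Real.exp (-L t ω) ^ b ∂P)) := by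
  refine tendsto_integral_of_dominated_convergence (fun _ => ‖g‖) (fun n => ?_)
    (integrable_const _) (fun n => Eventually.of_forall fun ω => ?_) ?_
  · exact (measurable_triggerFunctional b g
      (fun j => (hL.measurable (u j)).comp measurable_fst) ((hL.measurable t).comp measurable_fst)
      measurable_snd).stronglyMeasurable.integral_prod_right'.aestronglyMeasurable
  · exact (norm_integral_le_of_norm_le_const (C := ‖g‖) (Eventually.of_forall fun e =>
      norm_triggerFunctional_le _ _ _ _ _)).trans (by simp)
  · filter_upwards [hL.ae_path] with ω hω
    exact tendsto_integral_pi_exp hb g (fun j => hω.2.1 (u j)) (hω.2.1 t)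

/-- Integrating out an independent `Beta(1, b)` threshold for the proportion of failed
components. -/
lemma setIntegral_lt_passageTime_betaMeasure (hL : IsSubordinator L P) {b : ℝ} (hb : 0 < b)
    {G : Ω → ℝ} (hG : Measurable G) {M : ℝ} (hM : ∀ ω, ‖G ω‖ ≤ M) (t : ℝ≥0) :
    ∫ p in {p : Ω × ℝ | (t : ℝ≥0∞) < passageTime (fun s => L s p.1) (-Real.log (1 - p.2))},
        G p.1 ∂(P.prod (betaMeasure 1 b)) =
      ∫ ω, G ω * Real.exp (-L t ω) ^ b ∂P := by
  have := isProbabilityMeasureBeta one_pos hb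
  have hLt := hL.measurable t
  set B : Set (Ω × ℝ) := {p | 1 - Real.exp (-L t p.1) < p.2} with hB
  have hBm : MeasurableSet B := measurableSet_lt (by fun_prop) (by fun_prop)
  -- `Q` has no atoms, so given `L` it almost surely avoids the level at which passage by time `t`
  -- would be ambiguous.
  have hne : ∀ᵐ p ∂(P.prod (betaMeasure 1 b)), p.2 ≠ 1 - Real.exp (-L t p.1) := by
    rw [Measure.ae_prod_iff_ae_ae]
    · refine Eventually.of_forall fun ω => ?_
      simpa using (Set.countable_singleton (1 - Real.exp (-L t ω))).ae_notMem (betaMeasure 1 b)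
    · exact (measurableSet_eq_fun (by fun_prop) (by fun_prop)).compl
  have hset : {p : Ω × ℝ | (t : ℝ≥0∞) < passageTime (fun s => L s p.1) (-Real.log (1 - p.2))}
      =ᵐ[P.prod (betaMeasure 1 b)] B := by
    filter_upwards [Measure.quasiMeasurePreserving_fst.ae hL.ae_path,
      Measure.quasiMeasurePreserving_snd.ae (ae_betaMeasure_mem_Ioo 1 b), hne] with p hp hq hpq
    have hpos : 0 < 1 - p.2 := by linarith [hq.2]
    have hne' : -Real.log (1 - p.2) ≠ L t p.1 := fun h => hpq (by
      rw [← h, neg_neg, Real.exp_log hpos, sub_sub_cancel])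
    have hlog : -Real.log (1 - p.2) < L t p.1 ↔ Real.exp (-L t p.1) < 1 - p.2 := by
      rw [neg_lt, Real.lt_log_iff_exp_lt hpos]
    refine propext ?_
    change (t : ℝ≥0∞) < passageTime (fun s => L s p.1) (-Real.log (1 - p.2)) ↔
      1 - Real.exp (-L t p.1) < p.2
    rw [← not_le, passageTime_le_iff hp.1 (hp.2.2 t) hne', hlog, not_lt]
    constructor
    · intro h
      exact lt_of_le_of_ne (by linarith) hpq.symm
    · intro h
      linarith
  have hint : Integrable (B.indicator fun p => G p.1) (P.prod (betaMeasure 1 b)) :=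
    Integrable.of_bound ((hG.comp measurable_fst).indicator hBm).aestronglyMeasurable M
      (Eventually.of_forall fun p => (norm_indicator_le_norm_self _ _).trans (hM p.1))
  rw [setIntegral_congr_set hset, ← integral_indicator hBm, integral_prod _ hint]
  refine integral_congr_ae ?_
  filter_upwards [hL.ae_path] with ω hω
  have hind : ∀ q : ℝ, B.indicator (fun p => G p.1) (ω, q) =
      G ω * (Set.Ioi (1 - Real.exp (-L t ω))).indicator 1 q := fun q => by
    by_cases hq : 1 - Real.exp (-L t ω) < q
    · rw [Set.indicator_of_mem (show (ω, q) ∈ B from hq), Set.indicator_of_mem (Set.mem_Ioi.2 hq)]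
      simp
    · rw [Set.indicator_of_notMem (show (ω, q) ∉ B from hq),
        Set.indicator_of_notMem (by simpa using hq), mul_zero]
  have hexp : Real.exp (-L t ω) ≤ 1 := Real.exp_le_one_iff.2 (neg_nonpos.2 (hω.2.1 t))
  simp_rw [hind]
  rw [integral_const_mul, integral_indicator_one measurableSet_Ioi,
    betaMeasure_one_real_Ioi hb (by linarith) (by linarith [Real.exp_pos (-L t ω)]),
    sub_sub_cancel]

end Limit

end Reliability

theorem proposition1
    -- the common subordinator `L`
    {Ω : Type*} [MeasurableSpace Ω] (P : Measure Ω) [IsProbabilityMeasure P]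
    (L : ℝ≥0 → Ω → ℝ) (hL : IsSubordinator L P)
    -- for each `n ≥ 2`, the `n`-th system (random structure function `Φ n`, lifetimes `T n`)
    {Ω' : ℕ → Type*} [∀ n, MeasurableSpace (Ω' n)] (P' : ∀ n, Measure (Ω' n))
    [∀ n, IsProbabilityMeasure (P' n)]
    (Φ : ∀ n, Ω' n → StructureFunction n) (T : ∀ n, Ω' n → Fin n → ℝ≥0∞)
    (hΦ : ∀ n, 2 ≤ n → IsMixedCoherent (Φ n) (P' n))
    (hT : ∀ n, 2 ≤ n → HasLaw (T n) (lfmoLaw L P n) (P' n))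
    (hindep : ∀ n, 2 ≤ n → IndepFun (Φ n) (T n) (P' n))
    -- the signatures
    (b : ℝ) (hb : 0 < b) (C : ℕ → ℝ)
    (hC : ∀ n, 2 ≤ n → ∑ k ∈ Finset.Icc 1 n, C n * ((n : ℝ) - k + 1) ^ (b - 1) = 1)
    (hsig : ∀ n, 2 ≤ n → ∀ k ∈ Finset.Icc 1 n,
      signature (Φ n) (P' n) k = C n * ((n : ℝ) - k + 1) ^ (b - 1)) :
    -- the reliability function converges to `exp (-ψ(b) t)`
    (∀ t : ℝ, 0 < t →
      Tendsto (fun n => (P' n).real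
          {ω | ENNReal.ofReal t < systemFailureTime (Φ n ω) (T n ω)})
        atTop (𝓝 (Real.exp (-laplaceExponent L P b * t)))) ∧
    -- which, unless `L` vanishes, is the tail of the exponential distribution of rate `ψ(b) > 0`
    ((¬ ∀ᵐ ω ∂P, L 1 ω = 0) →
      0 < laplaceExponent L P b ∧
      ∀ t : ℝ, 0 < t →
        Tendsto (fun n => (P' n).real
            {ω | ENNReal.ofReal t < systemFailureTime (Φ n ω) (T n ω)})
          atTop (𝓝 ((expMeasure (laplaceExponent L P b)).real (Set.Ioi t)))) ∧
    -- the proportions `Q_n`, with `ℙ (Q_n = k / (n + 1)) = s_k`, converge in law to `Beta(1, b)`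
    (∀ f : ℝ →ᵇ ℝ,
      Tendsto (fun n : ℕ => ∑ k ∈ Finset.Icc 1 n,
          signature (Φ n) (P' n) k * f ((k : ℝ) / ((n : ℝ) + 1)))
        atTop (𝓝 (∫ q, f q ∂(betaMeasure 1 b)))) ∧
    -- jointly with the proportions of failed components at finitely many times `u j`, the failure
    -- time of the system converges in law to the first time at which the limiting proportion
    -- `1 - exp (-L_t)` of failed components exceeds `Q`, i.e. at which `L_t > -log (1 - Q)`,
    -- where `Q` is `Beta(1, b)` distributed and independent of `L`
    (∀ (m : ℕ) (u : Fin m → ℝ≥0) (g : (Fin m → ℝ) →ᵇ ℝ) (t : ℝ), 0 < t →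
      Tendsto (fun n =>
          ∫ ω in {ω | ENNReal.ofReal t < systemFailureTime (Φ n ω) (T n ω)},
            g (fun j => failedProportion (T n ω) (u j)) ∂(P' n))
        atTop
        (𝓝 (∫ p in {p : Ω × ℝ | ENNReal.ofReal t <
              passageTime (fun s => L s p.1) (-Real.log (1 - p.2))},
            g (fun j => 1 - Real.exp (-L (u j) p.1)) ∂(P.prod (betaMeasure 1 b))))) := by
  have hC' : ∀ n, 2 ≤ n → C n * powerSum b n = 1 := fun n hn => by
    have h := hC n hn
    rw [← Finset.mul_sum] at h
    have h2 := sum_Icc_rpow_eq_powerSum b n fun _ => 1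
    simp only [mul_one] at h2
    rwa [h2] at h
  have hjoint : ∀ (m : ℕ) (u : Fin m → ℝ≥0) (g : (Fin m → ℝ) →ᵇ ℝ) (t : ℝ),
      Tendsto (fun n =>
          ∫ ω in {ω | ENNReal.ofReal t < systemFailureTime (Φ n ω) (T n ω)},
            g (fun j => failedProportion (T n ω) (u j)) ∂(P' n))
        atTop
        (𝓝 (∫ ω, g (fun j => 1 - Real.exp (-L (u j) ω)) *
          Real.exp (-L (Real.toNNReal t) ω) ^ b ∂P)) := by
    intro m u g t
    refine (tendsto_integral_subordinator hL hb u g (Real.toNNReal t)).congr' ?_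
    filter_upwards [eventually_ge_atTop 2] with n hn
    exact (setIntegral_lt_systemFailureTime_lfmo hL (hΦ n hn) (hT n hn) (hindep n hn) (hC' n hn)
      (hsig n hn) u g (Real.toNNReal t)).symm
  have htail : ∀ t : ℝ, 0 < t → Tendsto (fun n => (P' n).real
      {ω | ENNReal.ofReal t < systemFailureTime (Φ n ω) (T n ω)})
        atTop (𝓝 (Real.exp (-laplaceExponent L P b * t))) := by
    intro t ht
    -- With no observation times and `g = 1`, the joint limit is the Laplace transform of `L_t` at
    -- `b`.
    have h := hjoint 0 Fin.elim0 1 t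
    have hlim := hL.integral_exp_eq hb.le (Real.toNNReal t)
    rw [Real.coe_toNNReal t ht.le] at hlim
    simp only [BoundedContinuousFunction.coe_one, Pi.one_apply, one_mul, integral_const,
      measureReal_restrict_apply_univ, smul_eq_mul, mul_one, ← Real.exp_mul] at h
    rw [← hlim]
    simpa only [mul_comm, neg_mul, mul_neg] using h
  refine ⟨htail, fun hne => ⟨hL.laplaceExponent_pos hb hne, fun t ht => ?_⟩, fun f => ?_,
    fun m u g t _ => ?_⟩
  · rw [expMeasure_real_Ioi (hL.laplaceExponent_pos hb hne) ht.le, ← neg_mul]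
    exact htail t ht
  · refine (tendsto_weighted_sum hb f.continuous).congr' ?_
    filter_upwards [eventually_ge_atTop 2] with n hn
    have hS := powerSum_pos b (show 0 < n by omega)
    have hCn : C n = 1 / powerSum b n := by rw [eq_div_iff hS.ne', hC' n hn]
    have hsum : ∀ k ∈ Finset.Icc 1 n,
        signature (Φ n) (P' n) k * f ((k : ℝ) / ((n : ℝ) + 1)) =
          C n * (((n : ℝ) - k + 1) ^ (b - 1) * f ((k : ℝ) / ((n : ℝ) + 1))) := fun k hk => by
      rw [hsig n hn k hk, mul_assoc]
    rw [Finset.sum_congr rfl hsum, ← Finset.mul_sum,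
      sum_Icc_rpow_eq_powerSum b n fun k => f ((k : ℝ) / ((n : ℝ) + 1)), hCn, one_div_mul_eq_div]
    congr 1
    refine Finset.sum_congr rfl fun i hi => ?_
    -- Under `k = n - i`, the point `k / (n + 1)` becomes `1 - (i + 1) / (n + 1)`, the node of the
    -- weighted Riemann sum.
    rw [Nat.cast_sub (Finset.mem_range.1 hi).le]
    congr 2
    field_simp
    ring
  · have hG : Measurable fun ω => g (fun j => 1 - Real.exp (-L (u j) ω)) := by
      refine g.continuous.measurable.comp (measurable_pi_lambda _ fun j => ?_)
      have := hL.measurable (u j)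
      fun_prop
    have h := setIntegral_lt_passageTime_betaMeasure hL hb hG
      (fun ω => g.norm_coe_le_norm _) (Real.toNNReal t)
    rw [show ENNReal.ofReal t = (Real.toNNReal t : ℝ≥0∞) from rfl, h]
    exact hjoint m u g t
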